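/- **Metropolis process.** For a finite nonempty graph $G=(V,E)$, let $\alpha(G)$ be the maximum size of an independent set. The (universal) Metropolis process on $G$ started from the empty set, with fugacity schedule $(\lambda_t)_{t\ge 1}$, $\lambda_t\in[1,\infty]$ (fugacity being an inverse temperature), is the sequence of random independent sets $(I_t)_{t\ge 0}$ with $I_0=\emptyset$ and, at each step $t\ge 1$: sample $v_t\in V$ and $\zeta_t\in[0,1]$ uniformly, independently of each other and of everything that happened before step $t$. If $v_t\notin I_{t-1}$, put $I_t=I_{t-1}\cup\{v_t\}$ if this set is independent, and $I_t=I_{t-1}$ otherwise. If $v_t\in I_{t-1}$, put $I_t=I_{t-1}\setminus\{v_t\}$ if $\zeta_t\le 1/\lambda_t$ (where $1/\infty=0$), and $I_t=I_{t-1}$ otherwise. The schedule may be adaptive: $\lambda_t$ may depend on everything that happened before step $t$ (the sets $I_s$ with $s<t$, the earlier samples, and additional randomness). Deterministic schedules are included; Simulated Annealing is the case of a deterministic nondecreasing sequence $(\lambda_t)$. **Theorem 1.2.** For every $\varepsilon\in(0,\tfrac12)$ there exist $\eta>0$ and a sequence of finite graphs $(G_n)_{n\ge 1}$, each with at least one vertex,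 such that: - $G_n$ has $\Theta(n)$ vertices and $\alpha(G_n)=\Theta(n^{1-2\varepsilon})$ as $n\to\infty$; - for every $n\ge 1$ and every fugacity schedule, possibly adaptive, the Metropolis process $(I_t)_{t\ge 0}$ on $G_n$ started from the empty set satisfies $$\mathbb P\Bigl(\max_{0\le t\le e^{n^{\eta}}}|I_t|\ \ge\ 2n^{\varepsilon}\Bigr)\ \le\ e^{-n^{\eta}}.$$ -/

import Mathlib

open MeasureTheory ProbabilityTheory Filter Asymptotics
open scoped ENNReal

namespace Metropolis

open Classical in
/-- One step of the Universal Metropolis Process on independent sets of `G`: the current set is `I`,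
the sampled vertex is `v`, the sampled threshold is `ζ ∈ [0,1]` and the fugacity is `lam ∈ [1,∞]`
(with the convention `1 / ∞ = 0`). A vertex outside `I` is added whenever the result is still an
independent set; a vertex of `I` is deleted exactly when `ζ ≤ 1 / lam`. -/
noncomputable def update {V : Type*} (G : SimpleGraph V)
    (I : Finset V) (v : V) (ζ : unitInterval) (lam : ℝ≥0∞) : Finset V :=
  if v ∉ I then
    if G.IsIndepSet (insert v I : Finset V) then insert v I else I
  else
    if ENNReal.ofReal (ζ : ℝ) ≤ lam⁻¹ then I.erase v else I

/-- `IsMetropolisProcess G μ ℱ v ζ lam I`: on the probability space `(Ω, μ)`, with `ℱ t` the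
information available after step `t`, the random sets `I 0, I 1, …` are the run on `G`, started from
the empty set, of the Universal Metropolis Process with the (possibly adaptive) fugacity schedule
`lam 1, lam 2, …`. The values of `v`, `ζ` and `lam` at time `0` play no role.

The fugacity of step `t + 1` may be any function of what is known after step `t`: the earlier sets,
vertices, thresholds and fugacities, and any additional randomness contained in `ℱ t`. In
particular deterministic schedules (Simulated Annealing being the nondecreasing ones), random
schedules independent of the run, and adaptive schedules are all included. -/
structure IsMetropolisProcess {V : Type*} [MeasurableSpace V] (G : SimpleGraph V)
    {Ω : Type*} {mΩ : MeasurableSpace Ω} (μ : Measure Ω) (ℱ : Filtration ℕ mΩ)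
    (v : ℕ → Ω → V) (ζ : ℕ → Ω → unitInterval) (lam : ℕ → Ω → ℝ≥0∞)
    (I : ℕ → Ω → Finset V) : Prop where
  /-- The vertex and the threshold of step `t + 1` are known after step `t + 1`. -/
  measurable_sample : ∀ t, Measurable[ℱ (t + 1)] (fun ω => (v (t + 1) ω, ζ (t + 1) ω))
  /-- The vertex is uniform on `V`, the threshold is uniform on `[0,1]`, and they are independent
  of one another. -/
  map_sample : ∀ t, μ.map (fun ω => (v (t + 1) ω, ζ (t + 1) ω)) =
    (uniformOn (Set.univ : Set V)).prod (volume : Measure unitInterval)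
  /-- The sample of step `t + 1` is independent of everything known after step `t`. -/
  indep_sample : ∀ t, Indep
    (MeasurableSpace.comap (fun ω => (v (t + 1) ω, ζ (t + 1) ω)) inferInstance) (ℱ t) μ
  /-- The fugacity of step `t + 1` is determined by what is known after step `t`. -/
  measurable_fugacity : ∀ t, Measurable[ℱ t] (lam (t + 1))
  one_le_fugacity : ∀ t ω, 1 ≤ lam (t + 1) ω
  init : ∀ ω, I 0 ω = ∅
  step : ∀ t ω, I (t + 1) ω = update G (I t ω) (v (t + 1) ω) (ζ (t + 1) ω) (lam (t + 1) ω)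

end Metropolis

/-! For `ε ≤ 1/3` the graph is a blow-up. It has about `n^ε` left types, each a clique of about
`n^(1-ε)` vertices, and an independent right part of about `n^(1-2ε)` vertices. Each right vertex
excludes a set of `q` left types, about the square root of their number, and these sets are almost
disjoint. The right part gives the independence number. An independent set exceeding the number of
left types by more than `k` needs more than `k` right vertices, so it suffices that a run never
collects `k + 1` of them, where `k` is a small power of `n`.

The obstacle is entropic and does not depend on the fugacity. With `k + 1` right vertices, almost
disjointness leaves room for at most `b` left ones. With at most `k` right vertices and fewer than
`b + k` left ones, at least `k` left types are free. A proposal there is always accepted and is far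
likelier than one of a right vertex or of an occupied left vertex, even if every proposed deletion
is carried out. A run could collect `k + 1` right vertices before the left side fills up, or after
the left count falls from `b + k` back to `b`; both are exponentially unlikely in `k`.

Both routes are controlled by one potential, the minimum of two exponential weights: one grows with
the right count, the other decays with the left count. `measureReal_exists_not_le` is the
supermartingale bound, `measureReal_exists_lt_card_le` applies it to this minimum, and
`exists_almost_disjoint` supplies the excluded sets from graphs of polynomials. For `ε ≥ 1/3` a
disjoint union of cliques has independence number at most `n^ε`, and nothing dynamical is needed. -/

namespace Metropolis

/-! ### One step of the process and a supermartingale bound -/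

open Classical in
/-- The largest value that `φ` can take after one step from `J` in which `v` is sampled. -/
noncomputable def stepBound {V : Type*} [DecidableEq V] (G : SimpleGraph V) (φ : Finset V → ℝ) (J : Finset V)
    (v : V) : ℝ :=
  if v ∈ J then max (φ J) (φ (J.erase v))
  else if G.IsIndepSet (insert v J : Finset V) then φ (insert v J) else φ J

/-- Taking the worse outcome of a proposed deletion removes the threshold and the fugacity; only the
sampled vertex stays random. This is why adaptive schedules need no separate treatment. -/
theorem le_stepBound {V : Type*} [inst : DecidableEq V] (G : SimpleGraph V) (φ : Finset V → ℝ) (J : Finset V)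
    (v : V) (z : unitInterval) (l : ℝ≥0∞) : φ (update G J v z l) ≤ stepBound G φ J v := by
  -- `update` uses classical decidability, so the given instance is first identified with it.
  obtain rfl : inst = fun a b => Classical.propDecidable (a = b) := Subsingleton.elim _ _
  unfold update stepBound
  by_cases h : v ∈ J
  · simp only [h, not_true_eq_false, if_false, if_true]
    split_ifs
    · exact le_max_right _ _
    · exact le_max_left _ _
  · simp only [h, not_false_eq_true, if_true, if_false]
    split_ifs <;> exact le_rfl

theorem stepBound_mono {V : Type*} [DecidableEq V] (G : SimpleGraph V) {φ ψ : Finset V → ℝ}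
    (h : ∀ J, φ J ≤ ψ J) (J : Finset V) (v : V) : stepBound G φ J v ≤ stepBound G ψ J v := by
  unfold stepBound
  split_ifs
  · exact max_le_max (h _) (h _)
  · exact h _
  · exact h _

theorem update_isIndepSet {V : Type*} (G : SimpleGraph V) {J : Finset V}
    (hJ : G.IsIndepSet (J : Set V)) (v : V) (z : unitInterval) (l : ℝ≥0∞) :
    G.IsIndepSet (update G J v z l : Set V) := by
  unfold update
  classical
  have he : G.IsIndepSet (J.erase v : Set V) := Set.Pairwise.mono (by simp) hJ
  split_ifs <;> assumption

namespace IsMetropolisProcess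

variable {V : Type*} [MeasurableSpace V] {G : SimpleGraph V}
    {Ω : Type*} {mΩ : MeasurableSpace Ω} {μ : Measure Ω} {ℱ : Filtration ℕ mΩ}
    {v : ℕ → Ω → V} {ζ : ℕ → Ω → unitInterval} {lam : ℕ → Ω → ℝ≥0∞} {I : ℕ → Ω → Finset V}

theorem isIndepSet (h : IsMetropolisProcess G μ ℱ v ζ lam I) (t : ℕ) (ω : Ω) :
    G.IsIndepSet (I t ω : Set V) := by
  induction t with
  | zero => rw [h.init]; simp [SimpleGraph.IsIndepSet]
  | succ t ih => rw [h.step]; exact update_isIndepSet G ih _ _ _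

theorem measurable_vertex (h : IsMetropolisProcess G μ ℱ v ζ lam I) (t : ℕ) :
    Measurable[ℱ (t + 1)] (v (t + 1)) :=
  measurable_fst.comp (h.measurable_sample t)

theorem indep_vertex (h : IsMetropolisProcess G μ ℱ v ζ lam I) (t : ℕ) :
    Indep (MeasurableSpace.comap (v (t + 1)) inferInstance) (ℱ t) μ := by
  refine indep_of_indep_of_le_left (h.indep_sample t) ?_
  have : v (t + 1) = Prod.fst ∘ fun ω => (v (t + 1) ω, ζ (t + 1) ω) := rfl
  rw [this, ← MeasurableSpace.comap_comp]
  exact MeasurableSpace.comap_mono measurable_fst.comap_le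

variable [Fintype V] [MeasurableSingletonClass V]

theorem measurable_state (h : IsMetropolisProcess G μ ℱ v ζ lam I) (t : ℕ) :
    @Measurable _ _ (ℱ t) ⊤ (I t) := by
  induction t with
  | zero =>
    have : I 0 = fun _ => ∅ := funext h.init
    rw [this]
    exact @measurable_const _ _ ⊤ (ℱ 0) _
  | succ t ih =>
    let _ : MeasurableSpace (Finset V) := ⊤
    have hI : Measurable[ℱ (t + 1)] (I t) := ih.mono (ℱ.mono (Nat.le_succ t)) le_rfl
    have hv := h.measurable_vertex t
    have hz : Measurable[ℱ (t + 1)] (ζ (t + 1)) := measurable_snd.comp (h.measurable_sample t)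
    have hl : Measurable[ℱ (t + 1)] (lam (t + 1)) :=
      (h.measurable_fugacity t).mono (ℱ.mono (Nat.le_succ t)) le_rfl
    have hB : MeasurableSet[ℱ (t + 1)]
        {ω | ENNReal.ofReal (ζ (t + 1) ω : ℝ) ≤ (lam (t + 1) ω)⁻¹} :=
      measurableSet_le
        (ENNReal.measurable_ofReal.comp (measurable_subtype_coe.comp hz)) (measurable_inv.comp hl)
    classical
    let f : Finset V × V → Finset V := fun p =>
      if p.2 ∉ p.1 then
        if G.IsIndepSet (insert p.2 p.1 : Finset V) then insert p.2 p.1 else p.1 else p.1.erase p.2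
    let g : Finset V × V → Finset V := fun p =>
      if p.2 ∉ p.1 then
        if G.IsIndepSet (insert p.2 p.1 : Finset V) then insert p.2 p.1 else p.1 else p.1
    have hp : Measurable[ℱ (t + 1)] fun ω => (I t ω, v (t + 1) ω) := hI.prodMk hv
    have hf : Measurable f := measurable_of_finite f
    have hg : Measurable g := measurable_of_finite g
    -- Threshold and fugacity enter only through one event. On either side of it the new set is a
    -- function on a finite type, hence measurable.
    have key : I (t + 1) = fun ω =>
        if ω ∈ {ω | ENNReal.ofReal (ζ (t + 1) ω : ℝ) ≤ (lam (t + 1) ω)⁻¹} then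
          f (I t ω, v (t + 1) ω) else g (I t ω, v (t + 1) ω) := by
      funext ω
      rw [h.step]
      unfold update
      simp only [f, g, Set.mem_ofPred_eq]
      split_ifs <;> rfl
    rw [key]
    exact Measurable.ite hB (hf.comp hp) (hg.comp hp)

theorem measureReal_vertex [Nonempty V] [IsProbabilityMeasure μ]
    (h : IsMetropolisProcess G μ ℱ v ζ lam I) (t : ℕ) (u : V) :
    μ.real (v (t + 1) ⁻¹' {u}) = (Fintype.card V : ℝ)⁻¹ := by
  have hm : Measurable fun ω => (v (t + 1) ω, ζ (t + 1) ω) :=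
    (h.measurable_sample t).mono (ℱ.le _) le_rfl
  have h1 : v (t + 1) ⁻¹' {u} =
      (fun ω => (v (t + 1) ω, ζ (t + 1) ω)) ⁻¹' ({u} ×ˢ Set.univ) := by
    ext; simp
  rw [h1, measureReal_def, ← Measure.map_apply hm
    ((measurableSet_singleton u).prod MeasurableSet.univ), h.map_sample, Measure.prod_prod,
    uniformOn_univ]
  simp

/-- Averaging over the vertex sampled in step `t + 1`. -/
theorem setIntegral_vertex [Nonempty V] [IsProbabilityMeasure μ]
    (h : IsMetropolisProcess G μ ℱ v ζ lam I)
    (t : ℕ) {E : Set Ω} (hE : MeasurableSet[ℱ t] E) (g : Finset V → V → ℝ) :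
    ∫ ω in E, g (I t ω) (v (t + 1) ω) ∂μ =
      ∫ ω in E, (Fintype.card V : ℝ)⁻¹ * ∑ u, g (I t ω) u ∂μ := by
  classical
  have hE' := ℱ.le t _ hE
  have hI := h.measurable_state t
  have hv : Measurable (v (t + 1)) := (h.measurable_vertex t).mono (ℱ.le _) le_rfl
  have hgm : ∀ u, Measurable[ℱ t] fun ω => E.indicator (fun ω => g (I t ω) u) ω := fun u =>
    ((@measurable_from_top _ _ _ fun J => g J u).comp hI).indicator hE
  have hbdd : ∃ C, ∀ J u, ‖g J u‖ ≤ C := by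
    refine ⟨∑ J, ∑ u, ‖g J u‖, fun J u => ?_⟩
    exact (Finset.single_le_sum (f := fun u => ‖g J u‖) (fun _ _ => norm_nonneg _)
      (Finset.mem_univ u)).trans (Finset.single_le_sum (f := fun J => ∑ u, ‖g J u‖)
      (fun _ _ => Finset.sum_nonneg fun _ _ => norm_nonneg _) (Finset.mem_univ J))
  obtain ⟨C, hC⟩ := hbdd
  have hgi : ∀ u, Integrable (fun ω => E.indicator (fun ω => g (I t ω) u) ω) μ := fun u => by
    refine Integrable.of_bound ((hgm u).mono (ℱ.le t) le_rfl).aestronglyMeasurable C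
      (Eventually.of_forall fun ω => ?_)
    exact (norm_indicator_le_norm_self _ _).trans (hC _ _)
  have hone : ∀ u, Measurable fun ω => (v (t + 1) ⁻¹' {u}).indicator (fun _ => (1 : ℝ)) ω :=
    fun u => measurable_const.indicator (hv (measurableSet_singleton u))
  -- The event that `u` is sampled is independent of the past, and both `E` and `I t` belong to the
  -- past.
  have hind : ∀ u, IndepFun (fun ω => (v (t + 1) ⁻¹' {u}).indicator (fun _ => (1 : ℝ)) ω)
      (fun ω => E.indicator (fun ω => g (I t ω) u) ω) μ := by
    intro u
    rw [IndepFun_iff_Indep]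
    refine indep_of_indep_of_le_left (indep_of_indep_of_le_right (h.indep_vertex t)
      (hgm u).comap_le) ?_
    refine Measurable.comap_le ?_
    exact (measurable_const.indicator ⟨{u}, measurableSet_singleton u, rfl⟩)
  have hprod : ∀ u, ∫ ω, (v (t + 1) ⁻¹' {u}).indicator (fun _ => (1 : ℝ)) ω *
      E.indicator (fun ω => g (I t ω) u) ω ∂μ =
      (Fintype.card V : ℝ)⁻¹ * ∫ ω, E.indicator (fun ω => g (I t ω) u) ω ∂μ := by
    intro u
    rw [(hind u).integral_fun_mul_eq_mul_integral (hone u).aestronglyMeasurable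
      (hgi u).aestronglyMeasurable,
      integral_indicator_const (1 : ℝ) (hv (measurableSet_singleton u)), h.measureReal_vertex]
    simp
  have hpi : ∀ u, Integrable (fun ω => (v (t + 1) ⁻¹' {u}).indicator (fun _ => (1 : ℝ)) ω *
      E.indicator (fun ω => g (I t ω) u) ω) μ := fun u => by
    refine Integrable.of_bound ((hone u).aestronglyMeasurable.mul
      (hgi u).aestronglyMeasurable) C (Eventually.of_forall fun ω => ?_)
    by_cases h1 : ω ∈ v (t + 1) ⁻¹' {u}
    · rw [Set.indicator_of_mem h1, one_mul]
      exact (norm_indicator_le_norm_self _ _).trans (hC (I t ω) u)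
    · simpa [Set.indicator_of_notMem h1] using (norm_nonneg _).trans (hC (I t ω) u)
  calc ∫ ω in E, g (I t ω) (v (t + 1) ω) ∂μ
      = ∫ ω, ∑ u, (v (t + 1) ⁻¹' {u}).indicator (fun _ => (1 : ℝ)) ω *
          E.indicator (fun ω => g (I t ω) u) ω ∂μ := by
        rw [← integral_indicator hE']
        refine integral_congr_ae (Eventually.of_forall fun ω => ?_)
        simp only [Set.indicator_apply, Set.mem_preimage, Set.mem_singleton_iff]
        simp
    _ = ∑ u, (Fintype.card V : ℝ)⁻¹ * ∫ ω, E.indicator (fun ω => g (I t ω) u) ω ∂μ := by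
        rw [integral_finsetSum _ fun u _ => hpi u]
        exact Finset.sum_congr rfl fun u _ => hprod u
    _ = ∫ ω in E, (Fintype.card V : ℝ)⁻¹ * ∑ u, g (I t ω) u ∂μ := by
        rw [← Finset.mul_sum, ← integral_finsetSum _ fun u _ => hgi u, ← integral_const_mul,
          ← integral_indicator hE']
        refine integral_congr_ae (Eventually.of_forall fun ω => ?_)
        by_cases hω : ω ∈ E <;> simp [hω]

theorem integrable_state [IsFiniteMeasure μ] (h : IsMetropolisProcess G μ ℱ v ζ lam I) (t : ℕ)
    (φ : Finset V → ℝ) : Integrable (fun ω => φ (I t ω)) μ := by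
  have hm : Measurable fun ω => φ (I t ω) :=
    (@measurable_from_top _ _ _ φ).comp ((h.measurable_state t).mono (ℱ.le t) le_rfl)
  refine Integrable.of_bound hm.aestronglyMeasurable (∑ J, ‖φ J‖)
    (Eventually.of_forall fun ω => ?_)
  exact Finset.single_le_sum (f := fun J => ‖φ J‖) (fun _ _ => norm_nonneg _)
    (Finset.mem_univ (I t ω))

/-- If the nonnegative potential `φ` increases by at most `δ` on average in each step from a good
state and is at least `1` at all other states, then the run is unlikely to leave the good states. -/
theorem measureReal_exists_not_le [DecidableEq V] [Nonempty V] [IsProbabilityMeasure μ]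
    (h : IsMetropolisProcess G μ ℱ v ζ lam I) (good : Finset V → Prop) (φ : Finset V → ℝ) (δ : ℝ)
    (hφ : ∀ J, 0 ≤ φ J) (hδ : 0 ≤ δ)
    (hgood : ∀ J : Finset V, G.IsIndepSet (J : Set V) → good J →
      ∑ u, stepBound G φ J u ≤ Fintype.card V * (φ J + δ))
    (hbad : ∀ J : Finset V, G.IsIndepSet (J : Set V) → ¬ good J → 1 ≤ φ J) (T : ℕ) :
    μ.real {ω | ∃ t < T, ¬ good (I t ω)} ≤ φ ∅ + T * δ := by
  -- The inequality `s < t` is strict, so `D (t + 1)` is already known after step `t` and the sample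
  -- of step `t + 1` is independent of it.
  let D : ℕ → Set Ω := fun t => {ω | ∀ s < t, good (I s ω)}
  have hset : ∀ t, MeasurableSet[ℱ t] {ω | good (I t ω)} := fun t =>
    h.measurable_state t (show MeasurableSet[⊤] {J | good J} from trivial)
  have hDs : ∀ t, D (t + 1) = D t ∩ {ω | good (I t ω)} := by
    intro t
    ext ω
    simp only [D, Set.mem_ofPred_eq, Set.mem_inter_iff]
    exact Nat.forall_lt_succ_right
  have hD : ∀ t, MeasurableSet[ℱ t] (D t) := by
    intro t
    induction t with
    | zero => simp [D]
    | succ t ih => rw [hDs]; exact ℱ.mono (Nat.le_succ t) _ (ih.inter (hset t))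
  -- Mass that has left the good states is counted with weight 1, the rest with weight `φ`; this
  -- total grows by at most `δ` per step.
  have key : ∀ t, μ.real (D t)ᶜ + ∫ ω in D t, φ (I t ω) ∂μ ≤ φ ∅ + t * δ := by
    intro t
    induction t with
    | zero => simp [D, h.init]
    | succ t ih =>
      have hi := h.integrable_state t φ
      have hE : MeasurableSet[ℱ t] (D (t + 1)) := by rw [hDs]; exact (hD t).inter (hset t)
      have hE' := ℱ.le t _ hE
      have hDm := ℱ.le t _ (hD t)
      have hdiff : D t \ D (t + 1) = D t \ {ω | good (I t ω)} := by
        rw [hDs, Set.sdiff_self_inter]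
      have hsub : D (t + 1) ⊆ D t := by rw [hDs]; exact Set.inter_subset_left
      have h1 : μ.real (D (t + 1))ᶜ = μ.real (D t)ᶜ + μ.real (D t \ D (t + 1)) := by
        rw [← measureReal_union _ (hDm.diff hE')]
        · congr 1
          ext ω
          have := @hsub ω
          simp only [Set.mem_compl_iff, Set.mem_union, Set.mem_sdiff]
          tauto
        · exact Set.disjoint_left.2 fun ω ha hb => ha hb.1
      have h2 : ∫ ω in D t, φ (I t ω) ∂μ =
          ∫ ω in D (t + 1), φ (I t ω) ∂μ + ∫ ω in D t \ D (t + 1), φ (I t ω) ∂μ := by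
        rw [← setIntegral_union Set.disjoint_sdiff_right (hDm.diff hE') hi.integrableOn
          hi.integrableOn, Set.union_sdiff_cancel hsub]
      -- Mass leaving now sits at bad states, where `φ ≥ 1`, so its potential pays for its weight.
      have h3 : μ.real (D t \ D (t + 1)) ≤ ∫ ω in D t \ D (t + 1), φ (I t ω) ∂μ := by
        have := setIntegral_mono_on (μ := μ) (f := fun _ => (1 : ℝ)) (g := fun ω => φ (I t ω))
          (integrable_const _).integrableOn hi.integrableOn (hDm.diff hE') (fun ω hω => by
            rw [hdiff] at hω
            exact hbad _ (h.isIndepSet t ω) hω.2)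
        simpa using this
      have hsi : ∀ ψ : Finset V → ℝ, IntegrableOn (fun ω => ψ (I t ω)) (D (t + 1)) μ :=
        fun ψ => (h.integrable_state t ψ).integrableOn
      have h4 : ∫ ω in D (t + 1), φ (I (t + 1) ω) ∂μ ≤
          ∫ ω in D (t + 1), stepBound G φ (I t ω) (v (t + 1) ω) ∂μ := by
        refine setIntegral_mono_on (h.integrable_state (t + 1) φ).integrableOn ?_ hE' ?_
        · refine Integrable.integrableOn ?_
          have hv : Measurable (v (t + 1)) := (h.measurable_vertex t).mono (ℱ.le _) le_rfl
          let _ : MeasurableSpace (Finset V) := ⊤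
          have hI : Measurable (I t) := (h.measurable_state t).mono (ℱ.le t) le_rfl
          have hm : Measurable fun ω => stepBound G φ (I t ω) (v (t + 1) ω) :=
            (measurable_of_finite fun p : Finset V × V => stepBound G φ p.1 p.2).comp
              (hI.prodMk hv)
          refine Integrable.of_bound hm.aestronglyMeasurable
            (∑ p : Finset V × V, ‖stepBound G φ p.1 p.2‖) (Eventually.of_forall fun ω => ?_)
          exact Finset.single_le_sum (f := fun p : Finset V × V => ‖stepBound G φ p.1 p.2‖)
            (fun _ _ => norm_nonneg _) (Finset.mem_univ (I t ω, v (t + 1) ω))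
        · intro ω _
          rw [h.step]
          exact le_stepBound G φ _ _ _ _
      rw [h.setIntegral_vertex t hE] at h4
      have h5 : ∫ ω in D (t + 1), (Fintype.card V : ℝ)⁻¹ * ∑ u, stepBound G φ (I t ω) u ∂μ ≤
          ∫ ω in D (t + 1), (φ (I t ω) + δ) ∂μ := by
        refine setIntegral_mono_on
          (hsi fun J => (Fintype.card V : ℝ)⁻¹ * ∑ u, stepBound G φ J u)
          (hsi fun J => φ J + δ) hE' fun ω hω => ?_
        rw [hDs] at hω
        rw [inv_mul_le_iff₀ (by exact_mod_cast Fintype.card_pos)]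
        exact hgood _ (h.isIndepSet t ω) hω.2
      have h6 : ∫ ω in D (t + 1), (φ (I t ω) + δ) ∂μ ≤ ∫ ω in D (t + 1), φ (I t ω) ∂μ + δ := by
        rw [integral_add (hsi φ) (integrable_const _).integrableOn]
        simp only [integral_const, measureReal_restrict_apply_univ, smul_eq_mul]
        have := mul_le_mul_of_nonneg_right (measureReal_le_one (μ := μ) (s := D (t + 1))) hδ
        linarith
      push_cast
      linarith
  have hev : {ω | ∃ t < T, ¬ good (I t ω)} = (D T)ᶜ := by
    ext ω
    simp [D]
  rw [hev]
  have h0 : 0 ≤ ∫ ω in D T, φ (I T ω) ∂μ := integral_nonneg fun ω => hφ _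
  linarith [key T]

end IsMetropolisProcess

end Metropolis

/-! ### Exponential potentials and their drift -/

namespace Metropolis

section Drift

variable {V : Type*} [Fintype V] [DecidableEq V]

/-- The exponential weight of a set `J` that counts the elements of `J` in `A` with weight `α` and
those outside `A` with weight `-β`. -/
noncomputable def expWeight (A : Finset V) (α β c : ℝ) (J : Finset V) : ℝ :=
  Real.exp (α * (J ∩ A).card - β * (J \ A).card + c)

open Classical in
/-- The vertices outside `A` that can be added to `J`. -/
noncomputable def addable (G : SimpleGraph V) (A J : Finset V) : Finset V :=
  {v | v ∉ A ∧ v ∉ J ∧ G.IsIndepSet (insert v J : Finset V)}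

theorem mem_addable {G : SimpleGraph V} {A J : Finset V} {v : V} :
    v ∈ addable G A J ↔ v ∉ A ∧ v ∉ J ∧ G.IsIndepSet (insert v J : Finset V) := by
  simp [addable]

/-- Every proposal in `A` is charged as an accepted addition and every proposal in `J \ A` as a
deletion. Only additions outside `A`, which no fugacity can prevent, are credited. -/
theorem stepBound_expWeight_le (G : SimpleGraph V) (A J : Finset V) {α β : ℝ} (c : ℝ)
    (hα : 0 ≤ α) (hβ : 0 ≤ β) (v : V) :
    stepBound G (expWeight A α β c) J v ≤ expWeight A α β c J *
      (1 + (if v ∈ A then Real.exp α - 1 else 0) + (if v ∈ J \ A then Real.exp β - 1 else 0)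
        - (if v ∈ addable G A J then 1 - Real.exp (-β) else 0)) := by
  have hpos : 0 < expWeight A α β c J := Real.exp_pos _
  have hea : 1 ≤ Real.exp α := Real.one_le_exp hα
  have heb : 1 ≤ Real.exp β := Real.one_le_exp hβ
  unfold stepBound
  by_cases hJ : v ∈ J
  · have hn : v ∉ addable G A J := fun h => (mem_addable.1 h).2.1 hJ
    by_cases hA : v ∈ A
    · have h1 : expWeight A α β c (J.erase v) ≤ expWeight A α β c J := by
        unfold expWeight
        have e1 : (J.erase v ∩ A).card ≤ (J ∩ A).card :=
          Finset.card_le_card (Finset.inter_subset_inter_right (Finset.erase_subset _ _))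
        have e2 : J.erase v \ A = J \ A := by
          ext x; simp only [Finset.mem_sdiff, Finset.mem_erase]
          constructor
          · tauto
          · rintro ⟨h1, h2⟩
            exact ⟨⟨fun h => h2 (h ▸ hA), h1⟩, h2⟩
        rw [e2]
        gcongr
      simp only [hJ, hA, hn, if_true, Finset.mem_sdiff, not_true_eq_false, and_false, if_false]
      rw [max_eq_left h1]
      nlinarith
    · have e1 : J.erase v ∩ A = J ∩ A := by
        ext x; simp only [Finset.mem_inter, Finset.mem_erase]
        constructor
        · tauto
        · rintro ⟨h1, h2⟩
          exact ⟨⟨fun h => hA (h ▸ h2), h1⟩, h2⟩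
      have e2 : (J.erase v \ A).card + 1 = (J \ A).card := by
        rw [Finset.erase_sdiff_comm]
        exact Finset.card_erase_add_one (by simp [hJ, hA])
      have h1 : expWeight A α β c (J.erase v) = expWeight A α β c J * Real.exp β := by
        unfold expWeight
        rw [e1, ← e2, ← Real.exp_add]
        push_cast
        ring_nf
      simp only [hJ, hA, hn, Finset.mem_sdiff, not_false_eq_true, if_false, and_self, if_true]
      rw [h1, max_eq_right (by nlinarith)]
      apply le_of_eq; ring
  · by_cases hI : G.IsIndepSet (insert v J : Finset V)
    · by_cases hA : v ∈ A
      · have hn : v ∉ addable G A J := fun h => (mem_addable.1 h).1 hA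
        have e1 : (insert v J ∩ A).card = (J ∩ A).card + 1 := by
          rw [Finset.insert_inter_of_mem hA, Finset.card_insert_of_notMem (by simp [hJ])]
        have e2 : insert v J \ A = J \ A := Finset.insert_sdiff_of_mem _ hA
        have h1 : expWeight A α β c (insert v J) = expWeight A α β c J * Real.exp α := by
          unfold expWeight
          rw [e1, e2, ← Real.exp_add]
          push_cast
          ring_nf
        simp only [hJ, hA, hI, hn, if_true, Finset.mem_sdiff, not_true_eq_false, and_false,
          if_false]
        rw [h1]
        apply le_of_eq; ring
      · have hn : v ∈ addable G A J := mem_addable.2 ⟨hA, hJ, hI⟩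
        have e1 : insert v J ∩ A = J ∩ A := Finset.insert_inter_of_notMem hA
        have e2 : (insert v J \ A).card = (J \ A).card + 1 := by
          rw [Finset.insert_sdiff_of_notMem _ hA, Finset.card_insert_of_notMem (by simp [hJ])]
        have h1 : expWeight A α β c (insert v J) = expWeight A α β c J * Real.exp (-β) := by
          unfold expWeight
          rw [e1, e2, ← Real.exp_add]
          push_cast
          ring_nf
        simp only [hJ, hA, hI, hn, if_true, Finset.mem_sdiff, not_false_eq_true, and_true,
          if_false]
        rw [h1]
        apply le_of_eq; ring
    · have : v ∉ addable G A J := fun h => hI (mem_addable.1 h).2.2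
      simp only [hJ, hI, this, if_false, Finset.mem_sdiff, false_and]
      split_ifs <;> nlinarith

theorem sum_stepBound_expWeight_le (G : SimpleGraph V) (A J : Finset V) {α β : ℝ} (c : ℝ)
    (hα : 0 ≤ α) (hβ : 0 ≤ β) :
    ∑ v, stepBound G (expWeight A α β c) J v ≤ expWeight A α β c J *
      (Fintype.card V + A.card * (Real.exp α - 1) + (J \ A).card * (Real.exp β - 1)
        - (addable G A J).card * (1 - Real.exp (-β))) := by
  refine (Finset.sum_le_sum fun v _ => stepBound_expWeight_le G A J c hα hβ v).trans ?_
  rw [← Finset.mul_sum, Finset.sum_sub_distrib, Finset.sum_add_distrib, Finset.sum_add_distrib]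
  simp only [Finset.sum_ite_mem, Finset.univ_inter, Finset.sum_const, nsmul_eq_mul, mul_one,
    Finset.card_univ]
  exact le_rfl

theorem sum_stepBound_expWeight_le_of_drift (G : SimpleGraph V) (A J : Finset V) {α β : ℝ} (c : ℝ)
    (hα : 0 ≤ α) (hβ : 0 ≤ β)
    (h : A.card * (Real.exp α - 1) + (J \ A).card * (Real.exp β - 1) ≤
      (addable G A J).card * (1 - Real.exp (-β))) :
    ∑ v, stepBound G (expWeight A α β c) J v ≤ Fintype.card V * expWeight A α β c J := by
  refine (sum_stepBound_expWeight_le G A J c hα hβ).trans ?_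
  have hpos : 0 < expWeight A α β c J := Real.exp_pos _
  nlinarith

theorem exp_sub_one_le_two_mul {x : ℝ} (h0 : 0 ≤ x) (h1 : x ≤ 1) : Real.exp x - 1 ≤ 2 * x := by
  have := Real.abs_exp_sub_one_le (x := x) (by rwa [abs_of_nonneg h0])
  rw [abs_of_nonneg h0] at this
  exact (le_abs_self _).trans this

theorem half_le_one_sub_exp_neg {x : ℝ} (h0 : 0 ≤ x) (h1 : x ≤ 1) :
    x / 2 ≤ 1 - Real.exp (-x) := by
  have h2 : Real.exp (-x) ≤ 1 / (1 + x) := by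
    rw [Real.exp_neg, one_div]
    exact inv_anti₀ (by linarith) (by linarith [Real.add_one_le_exp x])
  have h3 : 1 / (1 + x) ≤ 1 - x / 2 := by
    rw [div_le_iff₀ (by linarith)]
    nlinarith
  linarith

end Drift

/-- A run cannot collect more than `k` vertices of `A` if more than `k` vertices of `A` allow for at
most `b` other ones, while at most `k` of them leave many possible additions outside `A` as long
as fewer than `b + k` vertices are chosen there. -/
theorem IsMetropolisProcess.measureReal_exists_lt_card_le {V : Type*} [Fintype V] [DecidableEq V]
    [Nonempty V] [MeasurableSpace V] [MeasurableSingletonClass V] {G : SimpleGraph V}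
    {Ω : Type*} {mΩ : MeasurableSpace Ω} {μ : Measure Ω} [IsProbabilityMeasure μ]
    {ℱ : Filtration ℕ mΩ} {v : ℕ → Ω → V} {ζ : ℕ → Ω → unitInterval} {lam : ℕ → Ω → ℝ≥0∞}
    {I : ℕ → Ω → Finset V} (h : IsMetropolisProcess G μ ℱ v ζ lam I)
    (A : Finset V) (k b m w : ℕ) (hm : 0 < m)
    (hcard : ∀ J : Finset V, G.IsIndepSet (J : Set V) → (J \ A).card ≤ m)
    (hlarge : ∀ J : Finset V, G.IsIndepSet (J : Set V) → k < (J ∩ A).card → (J \ A).card ≤ b)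
    (hsmall : ∀ J : Finset V, G.IsIndepSet (J : Set V) → (J ∩ A).card ≤ k → (J \ A).card < b + k →
      w ≤ (addable G A J).card)
    (hw1 : 8 * m ≤ w) (hw2 : 8 * (A.card * m) ≤ w) (T : ℕ) :
    μ.real {ω | ∃ t < T, k < (I t ω ∩ A).card} ≤
      Real.exp (-k) + T * Real.exp (1 - k) := by
  have hm' : (0 : ℝ) < m := by exact_mod_cast hm
  have hm1 : (1 : ℝ) ≤ m := by exact_mod_cast hm
  -- With this weight the elements outside `A` lower the exponent of `f` by at most 1 in total, so
  -- `f ≥ 1` once `J` has `k + 1` elements in `A`.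
  set u : ℝ := 1 / m with hu
  have hu0 : 0 < u := by positivity
  have hum : u * m = 1 := by rw [hu]; field_simp
  have hu1 : u ≤ 1 := by rw [hu, div_le_one hm']; exact hm1
  -- `f` is tiny at the empty set and `g` is tiny once `b + k` vertices outside `A` are chosen; both
  -- are at least 1 at bad states.
  set f : Finset V → ℝ := expWeight A 1 u (-k) with hf
  set g : Finset V → ℝ := expWeight A 0 1 b with hg
  have hw1' : (8 : ℝ) * m ≤ w := by exact_mod_cast hw1
  have hw2' : (8 : ℝ) * (A.card * m) ≤ w := by exact_mod_cast hw2
  have hf0 : ∀ J, 0 < f J := fun J => Real.exp_pos _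
  have hg0 : ∀ J, 0 < g J := fun J => Real.exp_pos _
  have key := h.measureReal_exists_not_le (fun J => (J ∩ A).card ≤ k)
    (fun J => min (f J) (g J)) (Real.exp (1 - k))
    (fun J => le_min (hf0 J).le (hg0 J).le) (Real.exp_pos _).le ?_ ?_ T
  · have h0 : min (f ∅) (g ∅) ≤ Real.exp (-k) := by
      refine (min_le_left _ _).trans (le_of_eq ?_)
      simp [hf, expWeight]
    simp only [not_le] at key
    linarith
  · intro J hJ hk
    have hN : (0 : ℝ) < Fintype.card V := by exact_mod_cast Fintype.card_pos
    have hleft : ∑ v, stepBound G (fun J => min (f J) (g J)) J v ≤ ∑ v, stepBound G f J v :=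
      Finset.sum_le_sum fun v _ => stepBound_mono G (fun J => min_le_left _ _) J v
    have hright : ∑ v, stepBound G (fun J => min (f J) (g J)) J v ≤ ∑ v, stepBound G g J v :=
      Finset.sum_le_sum fun v _ => stepBound_mono G (fun J => min_le_right _ _) J v
    have hJm : ((J \ A).card : ℝ) ≤ m := by exact_mod_cast hcard J hJ
    have e1 : Real.exp 1 - 1 ≤ 2 := by
      have := exp_sub_one_le_two_mul (x := 1) zero_le_one le_rfl
      linarith
    have e2 : 1 / 2 ≤ 1 - Real.exp (-1) := half_le_one_sub_exp_neg zero_le_one le_rfl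
    have e3 := exp_sub_one_le_two_mul hu0.le hu1
    have e4 := half_le_one_sub_exp_neg hu0.le hu1
    have e5 : 0 ≤ Real.exp 1 - 1 := by linarith [Real.add_one_le_exp (1 : ℝ)]
    have e6 : 0 ≤ Real.exp u - 1 := by linarith [Real.add_one_le_exp u]
    by_cases hb : (J \ A).card < b + k
    · have hw : (w : ℝ) ≤ (addable G A J).card := by exact_mod_cast hsmall J hJ hk hb
      have hfJ : ∑ v, stepBound G f J v ≤ Fintype.card V * f J := by
        refine sum_stepBound_expWeight_le_of_drift G A J _ zero_le_one hu0.le ?_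
        -- The upward drift is at most `2 * A.card + 2`. The downward drift is at least `w * u / 2`,
        -- and the two bounds on `w` make each half of it cover one term; hence the factor 8.
        have i1 : (A.card : ℝ) * (Real.exp 1 - 1) ≤ A.card * 2 :=
          mul_le_mul_of_nonneg_left e1 (Nat.cast_nonneg _)
        have i2 : ((J \ A).card : ℝ) * (Real.exp u - 1) ≤ m * (2 * u) :=
          mul_le_mul hJm e3 e6 hm'.le
        have i3 : (w : ℝ) * (u / 2) ≤ (addable G A J).card * (1 - Real.exp (-u)) :=
          mul_le_mul hw e4 (by positivity) (Nat.cast_nonneg _)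
        have i4 : (8 : ℝ) * (A.card * m) * u ≤ w * u := mul_le_mul_of_nonneg_right hw2' hu0.le
        have i5 : (8 : ℝ) * m * u ≤ w * u := mul_le_mul_of_nonneg_right hw1' hu0.le
        have i6 : (8 : ℝ) * (A.card * m) * u = 8 * A.card := by
          linear_combination (8 : ℝ) * A.card * hum
        linarith
      have hgJ : ∑ v, stepBound G g J v ≤ Fintype.card V * g J := by
        refine sum_stepBound_expWeight_le_of_drift G A J _ le_rfl zero_le_one ?_
        rw [Real.exp_zero, sub_self, mul_zero, zero_add]
        have i2 : ((J \ A).card : ℝ) * (Real.exp 1 - 1) ≤ m * 2 :=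
          mul_le_mul hJm e1 e5 hm'.le
        have i3 : (w : ℝ) * (1 / 2) ≤ (addable G A J).card * (1 - Real.exp (-1)) :=
          mul_le_mul hw e2 (by positivity) (Nat.cast_nonneg _)
        linarith
      have : ∑ v, stepBound G (fun J => min (f J) (g J)) J v ≤
          Fintype.card V * min (f J) (g J) := by
        rw [mul_min_of_nonneg _ _ hN.le]
        exact le_min (hleft.trans hfJ) (hright.trans hgJ)
      have h2 : 0 < (Fintype.card V : ℝ) * Real.exp (1 - k) := mul_pos hN (Real.exp_pos _)
      linarith
    -- Here many additions need not be available, but `g J ≤ exp (-k)` and one step multiplies `g`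
    -- by at most `exp 1`. This is the source of the error `exp (1 - k)`.
    · refine hright.trans ?_
      refine (sum_stepBound_expWeight_le G A J (α := 0) (β := 1) b le_rfl zero_le_one).trans ?_
      have hgk : g J ≤ Real.exp (-k) := by
        refine Real.exp_le_exp.2 ?_
        have : (b : ℝ) + k ≤ (J \ A).card := by exact_mod_cast not_lt.1 hb
        linarith
      have hJN : ((J \ A).card : ℝ) ≤ Fintype.card V := by exact_mod_cast Finset.card_le_univ _
      have i1 : ((J \ A).card : ℝ) * (Real.exp 1 - 1) ≤ Fintype.card V * (Real.exp 1 - 1) :=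
        mul_le_mul_of_nonneg_right hJN e5
      have i2 : 0 ≤ ((addable G A J).card : ℝ) * (1 - Real.exp (-1)) :=
        mul_nonneg (Nat.cast_nonneg _) (by linarith)
      calc _ ≤ g J * (Fintype.card V * Real.exp 1) := by
            refine mul_le_mul_of_nonneg_left ?_ (hg0 J).le
            rw [Real.exp_zero]
            linarith
        _ ≤ Real.exp (-k) * (Fintype.card V * Real.exp 1) := by gcongr
        _ = Fintype.card V * Real.exp (1 - k) := by
            rw [sub_eq_add_neg, Real.exp_add]; ring
        _ ≤ _ := by
            gcongr
            linarith [le_min (hf0 J).le (hg0 J).le]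
  · intro J hJ hk
    simp only [not_le] at hk
    have h1 : ((J \ A).card : ℝ) ≤ b := by exact_mod_cast hlarge J hJ hk
    have h2 : (k : ℝ) + 1 ≤ (J ∩ A).card := by exact_mod_cast hk
    have h3 : ((J \ A).card : ℝ) ≤ m := by exact_mod_cast hcard J hJ
    refine le_min (Real.one_le_exp ?_) (Real.one_le_exp ?_)
    · have := mul_le_mul_of_nonneg_left h3 hu0.le
      linarith
    · linarith

end Metropolis

/-! ### Independent sets of the blow-up -/

/-- Two types of vertices of a blow-up exclude each other: every left type excludes itself, and the
right type `x` excludes the left types in `F x`. -/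
def conflict {ι X : Type*} (F : X → Finset ι) : ι ⊕ X → ι ⊕ X → Prop
  | .inl i, .inl j => i = j
  | .inl i, .inr x => i ∈ F x
  | .inr x, .inl i => i ∈ F x
  | .inr _, .inr _ => False

theorem conflict_symm {ι X : Type*} {F : X → Finset ι} {a b : ι ⊕ X} (h : conflict F a b) :
    conflict F b a := by
  rcases a with i | x <;> rcases b with j | y
  · exact Eq.symm h
  · exact h
  · exact h
  · exact h

/-- The graph in which the vertices of each left type form a clique, the vertices of right type form
an independent set, and vertices of the types `i` and `x` are adjacent when `i ∈ F x`. -/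
def blowup {V ι X : Type*} (π : V → ι ⊕ X) (F : X → Finset ι) : SimpleGraph V where
  Adj u v := u ≠ v ∧ conflict F (π u) (π v)
  symm := ⟨fun _ _ h => ⟨h.1.symm, conflict_symm h.2⟩⟩
  loopless := ⟨fun _ h => h.1 rfl⟩

namespace blowup

section Counting

set_option linter.unusedSectionVars false

variable {V ι X : Type*} [Fintype V] [DecidableEq V] [Fintype ι] [DecidableEq ι]
  [Fintype X] [DecidableEq X] {π : V → ι ⊕ X} {F : X → Finset ι}

/-- The vertices of right type. -/
def rightPart (π : V → ι ⊕ X) : Finset V := {v | (π v).isRight}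

/-- The left types that occur in `J`. -/
def leftTypes (π : V → ι ⊕ X) (J : Finset V) : Finset ι := {i | ∃ v ∈ J, π v = .inl i}

/-- The right types that occur in `J`. -/
def rightTypes (π : V → ι ⊕ X) (J : Finset V) : Finset X := {x | ∃ v ∈ J, π v = .inr x}

theorem image_leftTypes (J : Finset V) :
    (leftTypes π J).image Sum.inl = (J \ rightPart π).image π := by
  ext a
  rcases a with i | x
  · simp only [leftTypes, rightPart, Finset.mem_image, Finset.mem_filter, Finset.mem_univ,
      true_and, Finset.mem_sdiff, Sum.inl.injEq, exists_eq_right]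
    constructor
    · rintro ⟨v, h1, h2⟩
      exact ⟨v, ⟨h1, by simp [h2]⟩, h2⟩
    · rintro ⟨v, h1, h2⟩
      exact ⟨v, h1.1, h2⟩
  · simp only [rightPart, Finset.mem_image, Finset.mem_filter, Finset.mem_univ, true_and,
      Finset.mem_sdiff, reduceCtorEq, and_false, exists_false, false_iff, not_exists, not_and]
    rintro v ⟨-, h⟩ h2
    simp [h2] at h

theorem image_rightTypes (J : Finset V) :
    (rightTypes π J).image Sum.inr = (J ∩ rightPart π).image π := by
  ext a
  rcases a with i | x
  · simp only [rightPart, Finset.mem_image, Finset.mem_filter, Finset.mem_univ, true_and,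
      Finset.mem_inter, reduceCtorEq, and_false, exists_false, false_iff, not_exists, not_and]
    rintro v ⟨-, h⟩ h2
    simp [h2] at h
  · simp only [rightTypes, rightPart, Finset.mem_image, Finset.mem_filter, Finset.mem_univ,
      true_and, Finset.mem_inter, Sum.inr.injEq, exists_eq_right]
    constructor
    · rintro ⟨v, h1, h2⟩
      exact ⟨v, ⟨h1, by simp [h2]⟩, h2⟩
    · rintro ⟨v, h1, h2⟩
      exact ⟨v, h1.1, h2⟩

theorem not_conflict {J : Finset V} (hJ : (blowup π F).IsIndepSet (J : Set V)) {u v : V}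
    (hu : u ∈ J) (hv : v ∈ J) (huv : u ≠ v) : ¬ conflict F (π u) (π v) := fun h =>
  hJ (Finset.mem_coe.2 hu) (Finset.mem_coe.2 hv) huv ⟨huv, h⟩

/-- Each left type is a clique, so an independent set has at most one vertex of that type. -/
theorem card_leftTypes {J : Finset V} (hJ : (blowup π F).IsIndepSet (J : Set V)) :
    (leftTypes π J).card = (J \ rightPart π).card := by
  rw [← Finset.card_image_of_injective (leftTypes π J) (Sum.inl_injective (β := X)),
    image_leftTypes, Finset.card_image_of_injOn]
  intro u hu v hv huv
  simp only [Finset.coe_sdiff, Set.mem_sdiff, Finset.mem_coe, rightPart, Finset.mem_filter,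
    Finset.mem_univ, true_and] at hu hv
  by_contra hne
  have := not_conflict hJ hu.1 hv.1 hne
  rw [← huv] at this
  rcases h : π u with i | x
  · exact this (by rw [h]; rfl)
  · exact hu.2 (by simp [h])

theorem card_rightTypes (hπ : ∀ u v x, π u = .inr x → π v = .inr x → u = v) (J : Finset V) :
    (rightTypes π J).card = (J ∩ rightPart π).card := by
  rw [← Finset.card_image_of_injective (rightTypes π J) (Sum.inr_injective (α := ι)),
    image_rightTypes, Finset.card_image_of_injOn]
  intro u hu v hv huv
  simp only [Finset.coe_inter, Set.mem_inter_iff, Finset.mem_coe, rightPart, Finset.mem_filter,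
    Finset.mem_univ, true_and] at hu hv
  obtain ⟨x, hx⟩ := Sum.isRight_iff.1 hu.2
  exact hπ u v x hx (huv ▸ hx)

theorem disjoint_leftTypes {J : Finset V} (hJ : (blowup π F).IsIndepSet (J : Set V)) :
    Disjoint (leftTypes π J) ((rightTypes π J).biUnion F) := by
  rw [Finset.disjoint_left]
  intro i hi hi'
  simp only [leftTypes, rightTypes, Finset.mem_filter, Finset.mem_univ, true_and,
    Finset.mem_biUnion] at hi hi'
  obtain ⟨u, hu, hui⟩ := hi
  obtain ⟨x, ⟨v, hv, hvx⟩, hix⟩ := hi'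
  refine not_conflict hJ hu hv (fun h => ?_) (by rw [hui, hvx]; exact hix)
  rw [h, hvx] at hui
  cases hui

theorem card_sdiff_add_le {J : Finset V} (hJ : (blowup π F).IsIndepSet (J : Set V)) :
    (J \ rightPart π).card + ((rightTypes π J).biUnion F).card ≤ Fintype.card ι := by
  rw [← card_leftTypes hJ, ← Finset.card_union_of_disjoint (disjoint_leftTypes hJ)]
  exact Finset.card_le_univ _

/-- A left type neither occupied nor excluded by a chosen right vertex is free: each of its at least
`L` vertices can be added. -/
theorem le_card_addable {L : ℕ} (hL : ∀ i, L ≤ (Finset.univ.filter fun v => π v = .inl i).card)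
    {J : Finset V} (hJ : (blowup π F).IsIndepSet (J : Set V)) :
    (Fintype.card ι - ((J \ rightPart π).card + ((rightTypes π J).biUnion F).card)) * L ≤
      (Metropolis.addable (blowup π F) (rightPart π) J).card := by
  rw [← card_leftTypes hJ, ← Finset.card_union_of_disjoint (disjoint_leftTypes hJ),
    ← Finset.card_compl]
  set S := (leftTypes π J ∪ (rightTypes π J).biUnion F)ᶜ with hS
  have hsub : S.biUnion (fun i => Finset.univ.filter fun v => π v = .inl i) ⊆
      Metropolis.addable (blowup π F) (rightPart π) J := by
    intro v hv
    simp only [Finset.mem_biUnion, Finset.mem_filter, Finset.mem_univ, true_and] at hv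
    obtain ⟨i, hi, hvi⟩ := hv
    rw [hS, Finset.mem_compl, Finset.mem_union, not_or] at hi
    have hnc : ∀ u ∈ J, ¬ conflict F (π u) (π v) := by
      intro u hu hc
      rw [hvi] at hc
      rcases h : π u with j | x
      · rw [h] at hc
        have hji : j = i := hc
        exact hi.1 (by simpa [leftTypes] using ⟨u, hu, by rw [h, hji]⟩)
      · rw [h] at hc
        refine hi.2 (Finset.mem_biUnion.2 ⟨x, ?_, hc⟩)
        simpa [rightTypes] using ⟨u, hu, h⟩
    rw [Metropolis.mem_addable]
    refine ⟨by simp [rightPart, hvi], fun h => hnc v h (by rw [hvi]; rfl), ?_⟩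
    rw [Finset.coe_insert]
    intro a ha b hb hab hadj
    rcases ha with rfl | ha <;> rcases hb with rfl | hb
    · exact hab rfl
    · exact hnc b hb (conflict_symm hadj.2)
    · exact hnc a ha hadj.2
    · exact hJ ha hb hab hadj
  refine le_trans ?_ (Finset.card_le_card hsub)
  rw [Finset.card_biUnion]
  · rw [← smul_eq_mul]
    exact Finset.card_nsmul_le_sum _ _ _ fun i _ => hL i
  · intro i _ j _ hij
    rw [Function.onFun, Finset.disjoint_left]
    intro v hv hv'
    simp only [Finset.mem_filter, Finset.mem_univ, true_and] at hv hv'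
    rw [hv] at hv'
    exact hij (Sum.inl_injective hv')

theorem isIndepSet_rightPart : (blowup π F).IsIndepSet (rightPart π : Set V) := by
  intro u hu v hv _ h
  simp only [rightPart, Finset.coe_filter, Finset.mem_univ, true_and, Set.mem_ofPred_eq] at hu hv
  obtain ⟨x, hx⟩ := Sum.isRight_iff.1 hu
  obtain ⟨y, hy⟩ := Sum.isRight_iff.1 hv
  have := h.2
  rw [hx, hy] at this
  exact this

theorem card_le_of_isIndepSet {J : Finset V} (hJ : (blowup π F).IsIndepSet (J : Set V)) :
    J.card ≤ Fintype.card ι + (J ∩ rightPart π).card := by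
  have := card_sdiff_add_le hJ
  have := Finset.card_sdiff_add_card_inter J (rightPart π)
  omega

theorem card_left_le_indepNum (hsurj : ∀ i, ∃ v, π v = .inl i) :
    Fintype.card ι ≤ (blowup π F).indepNum := by
  choose f hf using hsurj
  have hinj : Function.Injective f := fun i j h => by
    have := hf i
    rw [h, hf j] at this
    exact (Sum.inl_injective this).symm
  have : (blowup π F).IsIndepSet (Finset.univ.image f : Finset V) := by
    rw [Finset.coe_image]
    rintro _ ⟨i, _, rfl⟩ _ ⟨j, _, rfl⟩ hne h
    have h2 := h.2
    rw [hf, hf] at h2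
    exact hne (congrArg f h2)
  have := this.card_le_indepNum
  rwa [Finset.card_image_of_injective _ hinj] at this

end Counting

end blowup

/-! ### Almost disjoint families -/

/-- Almost disjoint sets of the same size have a large union. -/
theorem card_mul_le_card_biUnion_add {ι X : Type*} [DecidableEq ι] [DecidableEq X]
    {F : X → Finset ι} {q r : ℕ} (hq : ∀ x, (F x).card = q)
    (hr : ∀ x y, x ≠ y → (F x ∩ F y).card ≤ r) (K : Finset X) :
    K.card * q ≤ (K.biUnion F).card + K.card ^ 2 * r := by
  induction K using Finset.induction_on with
  | empty => simp
  | insert x K hx ih =>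
    rw [Finset.biUnion_insert, Finset.card_insert_of_notMem hx]
    have h1 := Finset.card_union_add_card_inter (F x) (K.biUnion F)
    have h2 : (F x ∩ K.biUnion F).card ≤ K.card * r := by
      rw [Finset.inter_biUnion]
      exact Finset.card_biUnion_le_card_mul _ _ _ fun y hy => hr x y fun h => hx (h ▸ hy)
    rw [hq] at h1
    nlinarith

/-- Graphs of polynomials of degree less than `r` over a prime field are almost disjoint sets. -/
theorem exists_almost_disjoint {q r s : ℕ} [Fact q.Prime] (h : s ≤ q ^ r) :
    ∃ F : Fin s → Finset (ZMod q × ZMod q), (∀ x, (F x).card = q) ∧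
      ∀ x y, x ≠ y → (F x ∩ F y).card ≤ r := by
  have hcard : Fintype.card (Fin s) ≤ Fintype.card (Fin r → ZMod q) := by
    simpa [ZMod.card] using h
  obtain ⟨c⟩ := Function.Embedding.nonempty_of_card_le hcard
  let p : Fin s → Polynomial (ZMod q) := fun x => ((Polynomial.degreeLTEquiv (ZMod q) r).symm (c x))
  have hpd : ∀ x, p x ∈ Polynomial.degreeLT (ZMod q) r := fun x => Subtype.prop _
  have hp : Function.Injective p := fun x y hxy =>
    c.injective ((Polynomial.degreeLTEquiv (ZMod q) r).symm.injective (Subtype.ext hxy))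
  refine ⟨fun x => Finset.univ.image fun z => (z, (p x).eval z), fun x => ?_, fun x y hxy => ?_⟩
  · rw [Finset.card_image_of_injective _ fun a b hab => congrArg Prod.fst hab]
    simp [ZMod.card]
  · have hne : p x - p y ≠ 0 := sub_ne_zero.2 (hp.ne hxy)
    have hmem : p x - p y ∈ Polynomial.degreeLT (ZMod q) r := Submodule.sub_mem _ (hpd x) (hpd y)
    rw [Polynomial.mem_degreeLT, ← Polynomial.natDegree_lt_iff_degree_lt hne] at hmem
    refine le_trans ?_ ((Multiset.toFinset_card_le _).trans
      ((Polynomial.card_roots' (p x - p y)).trans hmem.le))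
    -- A common point of the two graphs is determined by its first coordinate, which is a root of `p
    -- x - p y`.
    refine Finset.card_le_card_of_injOn Prod.fst ?_ ?_
    · rintro ⟨z, w⟩ hz
      simp only [Finset.coe_inter, Finset.coe_image, Finset.coe_univ, Set.image_univ,
        Set.mem_inter_iff, Set.mem_range, Prod.mk.injEq, exists_eq_left] at hz
      simp [hne, hz.1, hz.2]
    · rintro ⟨z, w⟩ hz ⟨z', w'⟩ hz' hzz
      simp only [Finset.coe_inter, Finset.coe_image, Finset.coe_univ, Set.image_univ,
        Set.mem_inter_iff, Set.mem_range, Prod.mk.injEq, exists_eq_left] at hz hz' hzz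
      subst hzz
      rw [← hz.1, ← hz'.1]

/-! ### The process on the blow-up -/

/-- Runs on a blow-up with almost disjoint neighbourhoods stay small. -/
theorem Metropolis.IsMetropolisProcess.measureReal_exists_lt_card_le_of_blowup {V ι X : Type*}
    [Fintype V] [DecidableEq V] [Nonempty V] [MeasurableSpace V] [MeasurableSingletonClass V]
    [Fintype ι] [DecidableEq ι] [Nonempty ι] [Fintype X] [DecidableEq X]
    {π : V → ι ⊕ X} {F : X → Finset ι}
    {Ω : Type*} {mΩ : MeasurableSpace Ω} {μ : Measure Ω} [IsProbabilityMeasure μ]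
    {ℱ : Filtration ℕ mΩ} {v : ℕ → Ω → V} {ζ : ℕ → Ω → unitInterval} {lam : ℕ → Ω → ℝ≥0∞}
    {I : ℕ → Ω → Finset V} (h : IsMetropolisProcess (blowup π F) μ ℱ v ζ lam I)
    {q r k L : ℕ} (hπ : ∀ u v x, π u = .inr x → π v = .inr x → u = v)
    (hL : ∀ i, L ≤ (Finset.univ.filter fun v => π v = .inl i).card)
    (hq : ∀ x, (F x).card = q) (hr : ∀ x y, x ≠ y → (F x ∩ F y).card ≤ r)
    (h1 : (k + 1) * q ≤ Fintype.card ι) (h2 : (k + 1) ^ 2 * r + 2 * k ≤ q)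
    (h3 : 8 * Fintype.card ι ≤ k * L) (h4 : 8 * (Fintype.card X * Fintype.card ι) ≤ k * L)
    (T : ℕ) :
    μ.real {ω | ∃ t < T, Fintype.card ι + k < (I t ω).card} ≤
      Real.exp (-k) + T * Real.exp (1 - k) := by
  classical
  have hA : (blowup.rightPart π).card ≤ Fintype.card X := by
    have := blowup.card_rightTypes hπ Finset.univ
    rw [Finset.univ_inter] at this
    rw [← this]
    exact Finset.card_le_univ _
  -- Here `b` is the number of left types left over by `k + 1` excluded sets with maximal overlap.
  -- By `h1` the subtraction does not truncate. The value `w = k * L` stands for `k` free left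
  -- types.
  refine le_trans (measureReal_mono ?_) (h.measureReal_exists_lt_card_le (blowup.rightPart π) k
    (Fintype.card ι + (k + 1) ^ 2 * r - (k + 1) * q) (Fintype.card ι) (k * L) Fintype.card_pos
    (fun J hJ => ?_) (fun J hJ hk => ?_) (fun J hJ hk hb => ?_) h3 ?_ T)
  · rintro ω ⟨t, ht, hc⟩
    refine ⟨t, ht, ?_⟩
    have := blowup.card_le_of_isIndepSet (h.isIndepSet t ω)
    omega
  · have := blowup.card_sdiff_add_le hJ
    omega
  · rw [← blowup.card_rightTypes hπ] at hk
    -- Exactly `k + 1` right types are kept, because the overlap term is quadratic in their number.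
    obtain ⟨K, hK, hKc⟩ := Finset.exists_subset_card_eq (Nat.succ_le_of_lt hk)
    have e1 := blowup.card_sdiff_add_le hJ
    have e2 := Finset.card_le_card (Finset.biUnion_subset_biUnion_of_subset_left F hK)
    have e3 := card_mul_le_card_biUnion_add hq hr K
    rw [hKc, Nat.succ_eq_add_one] at e3
    omega
  · refine le_trans (Nat.mul_le_mul_right L ?_) (blowup.le_card_addable hL hJ)
    rw [← blowup.card_rightTypes hπ] at hk
    -- At most `k * q` left types are excluded and fewer than `b + k` are occupied, so more than `q
    -- - (k + 1) ^ 2 * r - k` are free, and `h2` makes this at least `k`.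
    have e1 : ((blowup.rightTypes π J).biUnion F).card ≤ k * q :=
      (Finset.card_biUnion_le_card_mul _ _ _ fun x _ => (hq x).le).trans
        (Nat.mul_le_mul_right q hk)
    have e2 : (k + 1) * q = k * q + q := by ring
    omega
  · exact le_trans (Nat.mul_le_mul_left 8 (Nat.mul_le_mul_right _ hA)) h4

/-- Distribution of `s` vertices of distinct right types and `L` vertices of each left type. -/
theorem exists_types (ι : Type*) [Fintype ι] [DecidableEq ι] (L s : ℕ) :
    ∃ π : Fin (Fintype.card ι * L + s) → ι ⊕ Fin s,
      (∀ u v x, π u = .inr x → π v = .inr x → u = v) ∧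
      (∀ i, L ≤ (Finset.univ.filter fun v => π v = .inl i).card) ∧
      ((blowup.rightPart π).card = s) := by
  have hc : Fintype.card ((ι × Fin L) ⊕ Fin s) = Fintype.card ι * L + s := by simp
  let e := Fintype.equivFinOfCardEq hc
  have hinj : ∀ u v x, Sum.map Prod.fst id (e.symm u) = (.inr x : ι ⊕ Fin s) →
      Sum.map Prod.fst id (e.symm v) = (.inr x : ι ⊕ Fin s) → u = v := by
    intro u v x hu hv
    apply e.symm.injective
    rcases h : e.symm u with a | a <;> rcases h' : e.symm v with b | b <;>
      simp_all
  refine ⟨fun v => Sum.map Prod.fst id (e.symm v), hinj, fun i => ?_, ?_⟩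
  · have : (Finset.univ.image fun l : Fin L => e (.inl (i, l))) ⊆
        Finset.univ.filter fun v => Sum.map Prod.fst id (e.symm v) = (.inl i : ι ⊕ Fin s) := by
      intro v hv
      obtain ⟨l, -, rfl⟩ := Finset.mem_image.1 hv
      simp
    have h2 := Finset.card_le_card this
    rw [Finset.card_image_of_injective] at h2
    · simpa using h2
    · intro a b hab
      simpa using hab
  · have h1 := blowup.card_rightTypes (π := fun v => Sum.map Prod.fst id (e.symm v)) hinj
      Finset.univ
    rw [Finset.univ_inter] at h1
    rw [← h1]
    have : blowup.rightTypes (fun v => Sum.map Prod.fst id (e.symm v) : _ → ι ⊕ Fin s)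
        Finset.univ = Finset.univ := by
      ext x
      simp only [blowup.rightTypes, Finset.mem_filter, Finset.mem_univ, true_and, iff_true]
      exact ⟨e (.inr x), by simp⟩
    rw [this]
    simp

-- Choice of the parameters

universe u

/-- On `G`, no run of the Metropolis process started from the empty set reaches size `B` within
time `exp x`, except with probability at most `exp (-x)`. -/
def SlowMetropolis {N : ℕ} (G : SimpleGraph (Fin N)) (B x : ℝ) : Prop :=
  ∀ (Ω : Type u) (mΩ : MeasurableSpace Ω) (μ : Measure Ω) (_ : IsProbabilityMeasure μ)
    (ℱ : Filtration ℕ mΩ) (v : ℕ → Ω → Fin N) (ζ : ℕ → Ω → unitInterval)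
    (lam : ℕ → Ω → ℝ≥0∞) (I : ℕ → Ω → Finset (Fin N)),
    Metropolis.IsMetropolisProcess G μ ℱ v ζ lam I →
    μ.real {ω | ∃ t : ℕ, (t : ℝ) ≤ Real.exp x ∧ B ≤ ((I t ω).card : ℝ)} ≤ Real.exp (-x)

theorem slowMetropolis_of_card_lt {N : ℕ} {G : SimpleGraph (Fin N)} {B x : ℝ}
    (h : ∀ J : Finset (Fin N), G.IsIndepSet (J : Set (Fin N)) → (J.card : ℝ) < B) :
    SlowMetropolis.{u} G B x := by
  intro Ω mΩ μ _ ℱ v ζ lam I hI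
  have : {ω | ∃ t : ℕ, (t : ℝ) ≤ Real.exp x ∧ B ≤ ((I t ω).card : ℝ)} = ∅ := by
    ext ω
    simp only [Set.mem_ofPred_eq, Set.mem_empty_iff_false, iff_false, not_exists, not_and, not_le]
    exact fun t _ => h _ (hI.isIndepSet t ω)
  rw [this]
  simpa using (Real.exp_pos _).le

/-- A graph with the size and the independence number asked for at `n`, up to a factor of `4`. -/
def HasHardGraph (n : ℕ) (a B x : ℝ) : Prop :=
  ∃ (N : ℕ) (G : SimpleGraph (Fin N)), 0 < N ∧ (n : ℝ) ≤ 4 * N ∧ (N : ℝ) ≤ 4 * n ∧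
    a ≤ 4 * G.indepNum ∧ (G.indepNum : ℝ) ≤ 4 * a ∧ SlowMetropolis.{u} G B x

theorem ceil_le_two_mul {x : ℝ} (hx : 1 ≤ x) : (⌈x⌉₊ : ℝ) ≤ 2 * x := by
  have := Nat.ceil_lt_add_one (zero_le_one.trans hx)
  linarith

theorem indepNum_le_of_forall {V : Type*} [Fintype V] {G : SimpleGraph V} {b : ℕ}
    (h : ∀ J : Finset V, G.IsIndepSet (J : Set V) → J.card ≤ b) : G.indepNum ≤ b := by
  obtain ⟨J, hJ⟩ := G.exists_isNIndepSet_indepNum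
  rw [← hJ.card_eq]
  exact h J hJ.isIndepSet

/-- For `1 / 3 ≤ ε` a union of cliques is enough. -/
theorem hasHardGraph_of_third_le {ε : ℝ} (h1 : 1 / 3 ≤ ε) (h2 : ε < 1 / 2) {n : ℕ} (hn : 1 ≤ n)
    (x : ℝ) : HasHardGraph.{u} n ((n : ℝ) ^ (1 - 2 * ε)) (2 * (n : ℝ) ^ ε) x := by
  have hn' : (1 : ℝ) ≤ n := by exact_mod_cast hn
  have hn0 : (0 : ℝ) < n := by linarith
  set a := (n : ℝ) ^ (1 - 2 * ε) with ha
  set b := (n : ℝ) ^ (2 * ε) with hb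
  have ha1 : 1 ≤ a := Real.one_le_rpow hn' (by linarith)
  have hb1 : 1 ≤ b := Real.one_le_rpow hn' (by linarith)
  have hab : a * b = n := by
    rw [ha, hb, ← Real.rpow_add hn0]
    simp
  set m := ⌊a⌋₊ with hm
  have hm1 : 1 ≤ m := Nat.le_floor (by simpa using ha1)
  have hma : (m : ℝ) ≤ a := Nat.floor_le (by linarith)
  have ham : a ≤ 2 * m := by
    have := Nat.lt_floor_add_one a
    have : (1 : ℝ) ≤ m := by exact_mod_cast hm1
    linarith
  set L := ⌈b⌉₊ with hL
  have hbL : b ≤ L := Nat.le_ceil b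
  have hLb : (L : ℝ) ≤ 2 * b := ceil_le_two_mul hb1
  have hL1 : 1 ≤ L := by
    have : (1 : ℝ) ≤ L := hb1.trans hbL
    exact_mod_cast this
  obtain ⟨π, hπ, hπL, hs⟩ := exists_types (Fin m) L 0
  have hcard : ∀ J : Finset (Fin (Fintype.card (Fin m) * L + 0)),
      (blowup π fun _ => ∅).IsIndepSet (J : Set (Fin (Fintype.card (Fin m) * L + 0))) →
        J.card ≤ m := by
    intro J hJ
    have := blowup.card_le_of_isIndepSet hJ
    have h0 : J ∩ blowup.rightPart π = ∅ := by
      rw [Finset.card_eq_zero.1 hs, Finset.inter_empty]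
    simpa [h0] using this
  have hup := indepNum_le_of_forall hcard
  have hlow : m ≤ (blowup π fun _ => ∅).indepNum := by
    have := blowup.card_left_le_indepNum (π := π) (F := fun _ => ∅) fun i => by
      obtain ⟨v, hv⟩ := Finset.card_pos.1 (lt_of_lt_of_le hL1 (hπL i))
      exact ⟨v, (Finset.mem_filter.1 hv).2⟩
    simpa using this
  have hup' : ((blowup π fun _ => ∅).indepNum : ℝ) ≤ m := by exact_mod_cast hup
  have hlow' : (m : ℝ) ≤ (blowup π fun _ => ∅).indepNum := by exact_mod_cast hlow
  have hN : ((Fintype.card (Fin m) * L + 0 : ℕ) : ℝ) = m * L := by simp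
  refine ⟨_, blowup π fun _ => ∅, ?_, ?_, ?_, ?_, ?_, slowMetropolis_of_card_lt fun J hJ => ?_⟩
  · simp only [Fintype.card_fin, add_zero]
    exact Nat.mul_pos hm1 hL1
  · rw [hN, ← hab]
    have := mul_le_mul ham hbL (by linarith) (by positivity)
    nlinarith
  · rw [hN, ← hab]
    have := mul_le_mul hma hLb (by positivity) (by linarith)
    nlinarith
  · linarith
  · linarith
  · have e1 : (J.card : ℝ) ≤ m := by exact_mod_cast hcard J hJ
    -- This is where `1/3 ≤ ε` enters: `1 - 2 * ε ≤ ε`.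
    have e2 : a ≤ (n : ℝ) ^ ε := Real.rpow_le_rpow_of_exponent_le hn' (by linarith)
    linarith

/-- The union bound over about `exp z` times costs a factor `exp z`, which is absorbed because `k`
is of order `z ^ 2`. The floor plus one counts all integer times up to `exp z`. -/
theorem exp_tail_le {y z : ℝ} {k : ℕ} (hk : y - 1 ≤ k) (hz : 4 ≤ z) (hy : y = z ^ 2) :
    Real.exp (-k) + (⌊Real.exp z⌋₊ + 1 : ℕ) * Real.exp (1 - k) ≤ Real.exp (-z) := by
  have h1 : ((⌊Real.exp z⌋₊ + 1 : ℕ) : ℝ) ≤ 2 * Real.exp z := by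
    push_cast
    have := Nat.floor_le (Real.exp_pos z).le
    have := Real.one_le_exp (x := z) (by linarith)
    linarith
  have h2 : Real.exp (-k) ≤ Real.exp z * Real.exp (1 - k) := by
    rw [← Real.exp_add]
    exact Real.exp_le_exp.2 (by linarith)
  have h3 : (3 : ℝ) ≤ Real.exp 2 := by linarith [Real.add_one_le_exp (2 : ℝ)]
  calc _ ≤ Real.exp z * Real.exp (1 - k) + 2 * Real.exp z * Real.exp (1 - k) := by gcongr
    _ = 3 * (Real.exp z * Real.exp (1 - k)) := by ring
    _ ≤ Real.exp 2 * (Real.exp z * Real.exp (1 - k)) := by gcongr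
    _ = Real.exp (2 + z + (1 - k)) := by rw [← Real.exp_add, ← Real.exp_add]; ring_nf
    _ ≤ Real.exp (-z) := Real.exp_le_exp.2 (by nlinarith)

/-- Bertrand's postulate at `⌊x⌋₊`. -/
theorem exists_prime_near {x : ℝ} (hx : 1 ≤ x) : ∃ q : ℕ, q.Prime ∧ x < q ∧ (q : ℝ) ≤ 2 * x := by
  have h1 : 1 ≤ ⌊x⌋₊ := Nat.le_floor (by simpa using hx)
  obtain ⟨q, hqp, hq1, hq2⟩ := Nat.exists_prime_lt_and_le_two_mul ⌊x⌋₊ (by omega)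
  refine ⟨q, hqp, (Nat.lt_floor_add_one x).trans_le (by exact_mod_cast hq1), ?_⟩
  have e1 : (q : ℝ) ≤ 2 * (⌊x⌋₊ : ℕ) := by exact_mod_cast hq2
  have e2 := Nat.floor_le (a := x) (by linarith)
  linarith

theorem sq_mul_add_le_of_pow_four_le {k r y q : ℝ} (hk : 0 ≤ k) (hky : k ≤ y) (hr : 0 ≤ r)
    (hy : 8 * r + 17 ≤ y) (hq : y ^ 4 / 2 ≤ q) : (k + 1) ^ 2 * r + 2 * k ≤ q := by
  have h1 : (k + 1) ^ 2 ≤ (2 * y) ^ 2 := pow_le_pow_left₀ (by linarith) (by linarith) 2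
  have h2 := mul_le_mul_of_nonneg_right h1 hr
  have h3 : y ≤ y ^ 2 := by nlinarith only [hy, hr]
  have h4 : (8 * r + 17) * y ^ 2 ≤ y ^ 2 * y ^ 2 :=
    mul_le_mul_of_nonneg_right (by linarith) (sq_nonneg y)
  nlinarith only [h2, h3, h4, hq, hky]

/-- For `ε ≤ 1 / 3` and large `n` a blow-up with almost disjoint neighbourhoods works. -/
theorem hasHardGraph_of_le_third {ε : ℝ} (h1 : 0 < ε) (h2 : ε ≤ 1 / 3) {n : ℕ} (hn : 1 ≤ n)
    {r : ℕ} (hr : 4 ≤ ε * r) (hy : 8 * r + 17 ≤ (n : ℝ) ^ (ε / 8)) :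
    HasHardGraph.{u} n ((n : ℝ) ^ (1 - 2 * ε)) (2 * (n : ℝ) ^ ε) ((n : ℝ) ^ (ε / 16)) := by
  have hn' : (1 : ℝ) ≤ n := by exact_mod_cast hn
  have hn0 : (0 : ℝ) < n := by linarith
  set y := (n : ℝ) ^ (ε / 8) with hydef
  set z := (n : ℝ) ^ (ε / 16) with hzdef
  set a := (n : ℝ) ^ (1 - 2 * ε) with ha
  set b := (n : ℝ) ^ (1 - ε) with hb
  set d := (n : ℝ) ^ ε with hd
  have hr0 : (0 : ℝ) ≤ r := Nat.cast_nonneg r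
  have hr1 : 1 ≤ r := by
    rcases Nat.eq_zero_or_pos r with h | h
    · rw [h] at hr; norm_num at hr
    · exact h
  have hy17 : 17 ≤ y := by linarith
  have hzy : y = z ^ 2 := by
    rw [hydef, hzdef, ← Real.rpow_natCast, ← Real.rpow_mul hn0.le]; norm_num; ring_nf
  have hz0 : 0 ≤ z := Real.rpow_nonneg hn0.le _
  have hz4 : 4 ≤ z := by nlinarith only [hzy, hy17, hz0]
  have hdy : d = y ^ 8 := by
    rw [hydef, hd, ← Real.rpow_natCast, ← Real.rpow_mul hn0.le]; norm_num
  have ha1 : 1 ≤ a := Real.one_le_rpow hn' (by linarith)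
  have hb1 : 1 ≤ b := Real.one_le_rpow hn' (by linarith)
  have hdb : d ≤ b := Real.rpow_le_rpow_of_exponent_le hn' (by linarith)
  -- This is where `ε ≤ 1/3` enters; it keeps the `q * q ≤ d` left types from dominating the
  -- independence number.
  have hda : d ≤ a := Real.rpow_le_rpow_of_exponent_le hn' (by linarith)
  have had : a * d = b := by
    rw [ha, hb, hd, ← Real.rpow_add hn0]; ring_nf
  have hbd : d * b = n := by
    rw [hb, hd, ← Real.rpow_add hn0]; simp
  have han : a ≤ n := by
    calc a ≤ (n : ℝ) ^ (1 : ℝ) := Real.rpow_le_rpow_of_exponent_le hn' (by linarith)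
      _ = n := Real.rpow_one _
  have hy2 : 17 * 17 ≤ y ^ 2 := by nlinarith only [hy17]
  have hy4 : 17 * 17 * y ^ 2 ≤ y ^ 4 := by nlinarith only [hy2]
  -- Since `d = y ^ 8`, a prime between `y ^ 4 / 2` and `y ^ 4` makes the number `q * q` of left
  -- types lie between `d / 4` and `d`.
  obtain ⟨q, hqp, hqlow, hqup⟩ := exists_prime_near (x := y ^ 4 / 2) (by linarith)
  have : Fact q.Prime := ⟨hqp⟩
  have hq0 : (0 : ℝ) ≤ q := Nat.cast_nonneg q
  replace hqup : (q : ℝ) ≤ y ^ 4 := by linarith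
  have hqd : (q : ℝ) * q ≤ d := by
    rw [hdy]
    calc (q : ℝ) * q ≤ y ^ 4 * y ^ 4 := mul_le_mul hqup hqup hq0 (by positivity)
      _ = y ^ 8 := by ring
  have hdq : d ≤ 4 * (q * q) := by
    rw [hdy]
    have := mul_le_mul hqlow.le hqlow.le (by positivity) hq0
    linarith only [this]
  set s := ⌈a⌉₊ with hs
  have has : a ≤ s := Nat.le_ceil a
  have hsa : (s : ℝ) ≤ 2 * a := ceil_le_two_mul ha1
  set L := ⌈b⌉₊ with hL
  have hbL : b ≤ L := Nat.le_ceil b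
  have hLb : (L : ℝ) ≤ 2 * b := ceil_le_two_mul hb1
  set k := ⌊y⌋₊ with hk
  have hky : (k : ℝ) ≤ y := Nat.floor_le (by linarith)
  have hyk : y < k + 1 := Nat.lt_floor_add_one y
  -- There are enough polynomials: `n ≤ (y ^ 2) ^ r` because `ε * r ≥ 4`, and `y ^ 2 ≤ y ^ 4 / 2 <
  -- q`.
  have hsq : s ≤ q ^ r := by
    have e1 : s ≤ n := Nat.ceil_le.2 han
    refine e1.trans ?_
    have e2 : (n : ℝ) ≤ (y ^ 2) ^ r := by
      rw [hydef, ← pow_mul, ← Real.rpow_natCast, ← Real.rpow_mul hn0.le]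
      calc (n : ℝ) = (n : ℝ) ^ (1 : ℝ) := (Real.rpow_one _).symm
        _ ≤ _ := Real.rpow_le_rpow_of_exponent_le hn' (by push_cast; linarith)
    have e3 : (y ^ 2) ^ r ≤ (q : ℝ) ^ r := by
      apply pow_le_pow_left₀ (by positivity)
      linarith
    exact_mod_cast e2.trans e3
  obtain ⟨F, hFq, hFr⟩ := exists_almost_disjoint hsq
  obtain ⟨π, hπ, hπL, hπs⟩ := exists_types (ZMod q × ZMod q) L s
  have hm : Fintype.card (ZMod q × ZMod q) = q * q := by simp [ZMod.card]
  have hgap : (k + 1) ^ 2 * r + 2 * k ≤ q := by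
    have := sq_mul_add_le_of_pow_four_le (Nat.cast_nonneg k) hky hr0 hy hqlow.le
    exact_mod_cast this
  have hkq : (k + 1) * q ≤ Fintype.card (ZMod q × ZMod q) := by
    rw [hm]
    refine Nat.mul_le_mul_right q (le_trans ?_ hgap)
    nlinarith only [hr1]
  have hqq : (q : ℝ) * q ≤ L := hqd.trans (hdb.trans hbL)
  -- The value 16 is what `h4` needs, since `s * (q * q) ≤ 2 * a * d = 2 * b ≤ 2 * L`.
  have hk16 : 16 ≤ k := Nat.le_floor (by push_cast; linarith)
  have hk16' : (16 : ℝ) ≤ k := by exact_mod_cast hk16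
  have hL0 : (0 : ℝ) ≤ L := Nat.cast_nonneg L
  have hkL : 16 * (L : ℝ) ≤ k * L := mul_le_mul_of_nonneg_right hk16' hL0
  have h3 : 8 * Fintype.card (ZMod q × ZMod q) ≤ k * L := by
    rw [hm]
    have : (8 : ℝ) * (q * q) ≤ k * L := by linarith
    exact_mod_cast this
  have h4 : 8 * (Fintype.card (Fin s) * Fintype.card (ZMod q × ZMod q)) ≤ k * L := by
    rw [hm, Fintype.card_fin]
    have e1 : (s : ℝ) * (q * q) ≤ 2 * a * d := mul_le_mul hsa hqd (by positivity) (by linarith)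
    have : (8 : ℝ) * (s * (q * q)) ≤ k * L := by linarith
    exact_mod_cast this
  have hN : ((Fintype.card (ZMod q × ZMod q) * L + s : ℕ) : ℝ) = q * q * L + s := by
    rw [hm]; push_cast; ring
  have hs1 : 0 < s := Nat.ceil_pos.2 (by linarith)
  have : Nonempty (Fin (Fintype.card (ZMod q × ZMod q) * L + s)) := ⟨⟨0, by omega⟩⟩
  have hlow : (s : ℝ) ≤ (blowup π F).indepNum := by
    have := (blowup.isIndepSet_rightPart (π := π) (F := F)).card_le_indepNum
    rw [hπs] at this
    exact_mod_cast this
  have hup : ((blowup π F).indepNum : ℝ) ≤ q * q + s := by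
    have : (blowup π F).indepNum ≤ q * q + s := by
      refine indepNum_le_of_forall fun J hJ => (blowup.card_le_of_isIndepSet hJ).trans ?_
      have : (J ∩ blowup.rightPart π).card ≤ s :=
        (Finset.card_le_card Finset.inter_subset_right).trans hπs.le
      exact add_le_add hm.le this
    exact_mod_cast this
  have hqLb : (q : ℝ) * q * L ≤ 2 * n := by
    calc (q : ℝ) * q * L ≤ d * (2 * b) := mul_le_mul hqd hLb hL0 (by positivity)
      _ = 2 * n := by rw [← hbd]; ring
  refine ⟨_, blowup π F, by omega, ?_, ?_, ?_, ?_, ?_⟩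
  · rw [hN]
    have : d * b ≤ 4 * (q * q) * L := mul_le_mul hdq hbL (by linarith) (by positivity)
    linarith [Nat.cast_nonneg (α := ℝ) s]
  · rw [hN]
    linarith
  · linarith
  · linarith
  · intro Ω mΩ μ _ ℱ v ζ lam I hI
    have key := hI.measureReal_exists_lt_card_le_of_blowup hπ hπL hFq hFr hkq hgap h3 h4
      (⌊Real.exp z⌋₊ + 1)
    refine le_trans (measureReal_mono ?_) (key.trans
      (exp_tail_le (by linarith) hz4 hzy))
    rintro ω ⟨t, ht, hc⟩
    refine ⟨t, Nat.lt_succ_of_le (Nat.le_floor ht), ?_⟩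
    refine lt_of_eq_of_lt (congrArg (· + k) hm) ?_
    -- Hence `q * q + k ≤ d + y < 2 * d`, so a set of size `2 * n ^ ε` exceeds the number of left
    -- types by more than `k`.
    have e1 : y < d := by
      rw [hdy]
      calc y = y ^ 1 := (pow_one y).symm
        _ < y ^ 8 := pow_lt_pow_right₀ (by linarith) (by norm_num)
    have : ((q * q + k : ℕ) : ℝ) < (I t ω).card := by push_cast; linarith
    exact Nat.cast_lt.1 this

/-- A family of graphs as required, up to finitely many indices. -/
theorem exists_eventually_hasHardGraph {ε : ℝ} (hε : 0 < ε) (hε' : ε < 1 / 2) :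
    ∃ η : ℝ, 0 < η ∧ ∀ᶠ n : ℕ in atTop,
      HasHardGraph.{u} n ((n : ℝ) ^ (1 - 2 * ε)) (2 * (n : ℝ) ^ ε) ((n : ℝ) ^ η) := by
  rcases le_total ε (1 / 3) with h | h
  · refine ⟨ε / 16, by positivity, ?_⟩
    obtain ⟨r, hr⟩ := exists_nat_ge (4 / ε)
    rw [div_le_iff₀ hε] at hr
    have ht : Tendsto (fun n : ℕ => (n : ℝ) ^ (ε / 8)) atTop atTop :=
      (tendsto_rpow_atTop (by positivity)).comp tendsto_natCast_atTop_atTop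
    filter_upwards [ht.eventually_ge_atTop (8 * r + 17), eventually_ge_atTop 1] with n hn hn1
    exact hasHardGraph_of_le_third hε h hn1 (by linarith) hn
  -- Any exponent would do, since the bound for unions of cliques holds at all times.
  · refine ⟨1, one_pos, ?_⟩
    filter_upwards [eventually_ge_atTop 1] with n hn
    exact hasHardGraph_of_third_le h hε' hn _

theorem theorem1p2 (ε : ℝ) (hε : 0 < ε) (hε' : ε < 1 / 2) :
    ∃ η : ℝ, 0 < η ∧
    ∃ (N : ℕ → ℕ) (G : ∀ n : ℕ, SimpleGraph (Fin (N n))),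
      (∀ n : ℕ, 1 ≤ n → 0 < N n) ∧
      (fun n : ℕ => (N n : ℝ)) =Θ[atTop] (fun n : ℕ => (n : ℝ)) ∧
      (fun n : ℕ => ((G n).indepNum : ℝ)) =Θ[atTop] (fun n : ℕ => (n : ℝ) ^ (1 - 2 * ε)) ∧
      ∀ n : ℕ, 1 ≤ n →
        ∀ (Ω : Type*) (mΩ : MeasurableSpace Ω) (μ : Measure Ω) (_ : IsProbabilityMeasure μ)
          (ℱ : Filtration ℕ mΩ) (v : ℕ → Ω → Fin (N n)) (ζ : ℕ → Ω → unitInterval)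
          (lam : ℕ → Ω → ℝ≥0∞) (I : ℕ → Ω → Finset (Fin (N n))),
          Metropolis.IsMetropolisProcess (G n) μ ℱ v ζ lam I →
          μ.real {ω | ∃ t : ℕ, (t : ℝ) ≤ Real.exp ((n : ℝ) ^ η) ∧
              2 * (n : ℝ) ^ ε ≤ ((I t ω).card : ℝ)}
            ≤ Real.exp (-(n : ℝ) ^ η) := by
  obtain ⟨η, hη, hev⟩ := exists_eventually_hasHardGraph hε hε'
  refine ⟨η, hη, ?_⟩
  -- The size bounds are kept conditional, as `Θ` only concerns large `n`, while the slowness must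
  -- hold for every `n ≥ 1`.
  have hall : ∀ n : ℕ, ∃ (N : ℕ) (G : SimpleGraph (Fin N)), (1 ≤ n → 0 < N) ∧
      (1 ≤ n → SlowMetropolis G (2 * (n : ℝ) ^ ε) ((n : ℝ) ^ η)) ∧
      (HasHardGraph n ((n : ℝ) ^ (1 - 2 * ε)) (2 * (n : ℝ) ^ ε) ((n : ℝ) ^ η) →
        (n : ℝ) ≤ 4 * N ∧ (N : ℝ) ≤ 4 * n ∧ (n : ℝ) ^ (1 - 2 * ε) ≤ 4 * G.indepNum ∧
        (G.indepNum : ℝ) ≤ 4 * (n : ℝ) ^ (1 - 2 * ε)) := by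
    intro n
    by_cases hn : HasHardGraph n ((n : ℝ) ^ (1 - 2 * ε)) (2 * (n : ℝ) ^ ε) ((n : ℝ) ^ η)
    · obtain ⟨N, G, h0, h1, h2, h3, h4, h5⟩ := id hn
      exact ⟨N, G, fun _ => h0, fun _ => h5, fun _ => ⟨h1, h2, h3, h4⟩⟩
    -- At the remaining indices a single vertex suffices, because `1 < 2 * n ^ ε`.
    · refine ⟨1, ⊥, fun _ => one_pos, fun h1 => slowMetropolis_of_card_lt fun J _ => ?_,
        fun h => absurd h hn⟩
      have e1 : (J.card : ℝ) ≤ 1 := by exact_mod_cast (Finset.card_le_univ J)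
      have e2 : 1 ≤ (n : ℝ) ^ ε := Real.one_le_rpow (by exact_mod_cast h1) hε.le
      linarith
  choose N G hpos hslow hbd using hall
  refine ⟨N, G, hpos, ⟨?_, ?_⟩, ⟨?_, ?_⟩, hslow⟩
  · refine IsBigO.of_bound 4 (hev.mono fun n hn => ?_)
    simpa using (hbd n hn).2.1
  · refine IsBigO.of_bound 4 (hev.mono fun n hn => ?_)
    simpa using (hbd n hn).1
  · refine IsBigO.of_bound 4 (hev.mono fun n hn => ?_)
    rw [Real.norm_of_nonneg (Nat.cast_nonneg _), Real.norm_of_nonneg (by positivity)]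
    exact (hbd n hn).2.2.2
  · refine IsBigO.of_bound 4 (hev.mono fun n hn => ?_)
    rw [Real.norm_of_nonneg (Nat.cast_nonneg _), Real.norm_of_nonneg (by positivity)]
    exact (hbd n hn).2.2.1
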